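/- Consider $K\ge 1$ devices that report to an access point with $N\ge K$ antennas, and let $\sigma,P,\Omega,\gamma>0$ be the noise standard deviation, the transmit power, the channel gain (with the product $P\Omega$ common to all devices) and the SNR threshold. Put $c=\sigma^2\gamma/(P\Omega)$ and, for $0\le k\le K$, $$P_e(k)=1-\sum_{i=0}^{N-k}\frac{c^i}{i!}e^{-c}.$$ The AoI-scheduling MDP has as states the age vectors $\mathbf s=(\delta_1,\dots,\delta_K)$ of positive integers ($\mathcal S=\{1,2,\dots\}^K$), as actions the binary vectors $\mathbf a=(I_1,\dots,I_K)\in\mathcal A=\{0,1\}^K$, and as one-stage cost the average age $r(\mathbf s,\mathbf a)=\omega(\mathbf s)=\frac1K\sum_{i=1}^K\delta_i$. Given state $\mathbf s$ and action $\mathbf a$, independently over the devices, the next age of device $i$ is $1$ with probability $I_i\,[1-P_e(\sum_j I_j)]$ and $\delta_i+1$ otherwise. For a (possibly history-dependent and randomized) policy $\pi$ and an initial state $\mathbf s_0$ let $$C(\pi,\mathbf s_0)=\limsup_{T\to\infty}\frac1T\sum_{t=0}^{T}\mathbb E^{\pi}_{\mathbf s_0}[r(\mathbf s_t,\mathbf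 a_t)]\in[0,\infty].$$ Then there exist a constant $J^*\in\mathbb R$, a function $h:\mathcal S\to\mathbb R$ that is bounded in the $\omega$-weighted supremum norm (that is, $|h(\mathbf s)|\le M\,\omega(\mathbf s)$ for all $\mathbf s\in\mathcal S$ and some constant $M$), and a stationary deterministic policy $\pi^*:\mathcal S\to\mathcal A$ such that, for all $\mathbf s\in\mathcal S$, $$J^*+h(\mathbf s)=\min_{\mathbf a\in\mathcal A}\bigl\{r(\mathbf s,\mathbf a)+\mathbb E[h(\mathbf s')\mid \mathbf s,\mathbf a]\bigr\},$$ where $\mathbf s'$ is the next state after $\mathbf s$ under action $\mathbf a$, the minimum is attained at $\mathbf a=\pi^*(\mathbf s)$, and for every initial state $\mathbf s_0$ one has $C(\pi^*,\mathbf s_0)=J^*\le C(\pi,\mathbf s_0)$ for every policy $\pi$; that is, $J^*$ is the optimal long-run average AoI and $\pi^*$ is an optimal policy. -/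

import Mathlib

namespace AoI

/-- Parameters of a symmetric multiuser MIMO uplink with `K` devices: number of antennas `N ≥ K`,
noise standard deviation `σ`, the (common) product of the transmit power `P` and the channel
gain `Ω`, and the SNR decoding threshold `γ`. -/
structure Params (K : ℕ) where
  N : ℕ
  σ : ℝ
  P : ℝ
  Ω : ℝ
  γ : ℝ
  card_le : K ≤ N
  σ_pos : 0 < σ
  P_pos : 0 < P
  Ω_pos : 0 < Ω
  γ_pos : 0 < γ

/-- Age vectors: the age of every device is a positive integer. -/
abbrev State (K : ℕ) : Type := Fin K → ℕ+

/-- Scheduling vectors: `a i = true` means that device `i` is scheduled. -/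
abbrev Action (K : ℕ) : Type := Fin K → Bool

/-- The number of scheduled devices. -/
def numScheduled {K : ℕ} (a : Action K) : ℕ := (Finset.univ.filter fun i => a i = true).card

noncomputable section

variable {K : ℕ}

/-- The normalized threshold `σ² γ / (P Ω)`. -/
def Params.c (p : Params K) : ℝ := p.σ ^ 2 / (p.P * p.Ω) * p.γ

/-- The zero-forcing error (outage) probability of each of `k` simultaneously scheduled devices. -/
def Params.errorProb (p : Params K) (k : ℕ) : ℝ :=
  1 - ∑ i ∈ Finset.range (p.N - k + 1), p.c ^ i / (i.factorial : ℝ) * Real.exp (-p.c)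

theorem Params.c_nonneg (p : Params K) : 0 ≤ p.c := by
  have h1 := p.P_pos
  have h2 := p.Ω_pos
  have h3 := p.γ_pos
  unfold Params.c
  positivity

theorem Params.errorProb_nonneg (p : Params K) (k : ℕ) : 0 ≤ p.errorProb k := by
  have h := Real.sum_le_exp_of_nonneg p.c_nonneg (p.N - k + 1)
  have h2 : (∑ i ∈ Finset.range (p.N - k + 1), p.c ^ i / (i.factorial : ℝ)) * Real.exp (-p.c)
      ≤ Real.exp p.c * Real.exp (-p.c) :=
    mul_le_mul_of_nonneg_right h (Real.exp_nonneg _)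
  rw [← Real.exp_add, add_neg_cancel, Real.exp_zero] at h2
  unfold Params.errorProb
  rw [← Finset.sum_mul]
  linarith

theorem Params.errorProb_le_one (p : Params K) (k : ℕ) : p.errorProb k ≤ 1 := by
  have h1 := p.c_nonneg
  have h2 : 0 ≤ ∑ i ∈ Finset.range (p.N - k + 1),
      p.c ^ i / (i.factorial : ℝ) * Real.exp (-p.c) :=
    Finset.sum_nonneg fun i _ => by positivity
  unfold Params.errorProb
  linarith

/-- The probability that a fresh update of device `i` is received in a slot with action `a`:
`I_i (1 - P_e(∑ I_j))`. -/
def Params.successProb (p : Params K) (a : Action K) (i : Fin K) : ℝ :=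
  if a i then 1 - p.errorProb (numScheduled a) else 0

theorem Params.successProb_nonneg (p : Params K) (a : Action K) (i : Fin K) :
    0 ≤ p.successProb a i := by
  have := p.errorProb_le_one (numScheduled a)
  unfold Params.successProb
  split_ifs <;> linarith

theorem Params.successProb_le_one (p : Params K) (a : Action K) (i : Fin K) :
    p.successProb a i ≤ 1 := by
  have := p.errorProb_nonneg (numScheduled a)
  unfold Params.successProb
  split_ifs <;> linarith

/-- The probability, under action `a`, that the set of devices whose update is received
is exactly `{i | x i = true}` (devices succeed independently of each other). -/
def Params.outcomeProb (p : Params K) (a : Action K) (x : Fin K → Bool) : ℝ :=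
  ∏ i, if x i then p.successProb a i else 1 - p.successProb a i

theorem Params.outcomeProb_nonneg (p : Params K) (a : Action K) (x : Fin K → Bool) :
    0 ≤ p.outcomeProb a x := by
  refine Finset.prod_nonneg fun i _ => ?_
  have h1 := p.successProb_nonneg a i
  have h2 := p.successProb_le_one a i
  split_ifs <;> linarith

theorem Params.sum_outcomeProb (p : Params K) (a : Action K) :
    ∑ x, p.outcomeProb a x = 1 := by
  have h := Finset.prod_univ_sum (fun _ : Fin K => (Finset.univ : Finset Bool))
    (fun i b => if b then p.successProb a i else 1 - p.successProb a i)
  simp only [Fintype.piFinset_univ] at h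
  unfold Params.outcomeProb
  rw [← h]
  simp

/-- The law of the vector of reception indicators in a slot with action `a`. -/
def Params.outcomeLaw (p : Params K) (a : Action K) : PMF (Fin K → Bool) :=
  PMF.ofFintype (fun x => ENNReal.ofReal (p.outcomeProb a x)) (by
    rw [← ENNReal.ofReal_sum_of_nonneg fun x _ => p.outcomeProb_nonneg a x,
      p.sum_outcomeProb a, ENNReal.ofReal_one])

/-- The age of a device drops to one if its update is received, and grows by one otherwise. -/
def nextState (s : State K) (x : Fin K → Bool) : State K := fun i => if x i then 1 else s i + 1

/-- The transition law `P_a(s, ·)`. -/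
def Params.trans (p : Params K) (s : State K) (a : Action K) : PMF (State K) :=
  (p.outcomeLaw a).map (nextState s)

/-- The expectation of `h(s')`, where `s'` is the next state after `s` under action `a`. -/
def Params.expNext (p : Params K) (h : State K → ℝ) (s : State K) (a : Action K) : ℝ :=
  ∑ x, p.outcomeProb a x * h (nextState s x)

/-- The average age. -/
def avgAge (s : State K) : ℝ := (1 / (K : ℝ)) * ∑ i, ((s i : ℕ) : ℝ)

/-- The one-stage cost. -/
def cost (s : State K) (_a : Action K) : ℝ := avgAge s

/-- A history-dependent randomized policy: given the past states and actions
`(s_{t-1}, a_{t-1}), …, (s_0, a_0)` (most recent first) and the current state `s_t`,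
the law of the action `a_t`. -/
abbrev Policy (K : ℕ) : Type := List (State K × Action K) → State K → PMF (Action K)

/-- The stationary deterministic policy given by a map from states to actions. -/
def stationary (f : State K → Action K) : Policy K := fun _ s => PMF.pure (f s)

/-- The law of the history up to time `t` (past state-action pairs, and the current state `s_t`)
under the policy `π`, started at `s₀`. -/
def Params.historyLaw (p : Params K) (π : Policy K) (s₀ : State K) :
    ℕ → PMF (List (State K × Action K) × State K)
  | 0 => PMF.pure ([], s₀)
  | t + 1 => (p.historyLaw π s₀ t).bind fun H => (π H.1 H.2).bind fun a =>
      (p.trans H.2 a).map fun s' => ((H.2, a) :: H.1, s')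

/-- The law of `(s_t, a_t)` under the policy `π`, started at `s₀`. -/
def Params.stateActionLaw (p : Params K) (π : Policy K) (s₀ : State K) (t : ℕ) :
    PMF (State K × Action K) :=
  (p.historyLaw π s₀ t).bind fun H => (π H.1 H.2).map fun a => (H.2, a)

/-- The expected cost at time `t`. -/
def Params.expCost (p : Params K) (π : Policy K) (s₀ : State K) (t : ℕ) : ENNReal :=
  ∑' z : State K × Action K, p.stateActionLaw π s₀ t z * ENNReal.ofReal (cost z.1 z.2)

/-- The long-run average expected cost `limsup_T (1/T) ∑_{t=0}^T E[r(s_t, a_t)]`. -/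
def Params.avgCost (p : Params K) (π : Policy K) (s₀ : State K) : ENNReal :=
  Filter.limsup (fun T : ℕ => (∑ t ∈ Finset.range (T + 1), p.expCost π s₀ t) / (T : ENNReal))
    Filter.atTop

end

end AoI

/-! The proof is by vanishing discount. Scheduling every device resets all ages to one with a fixed
probability `q > 0` (`resetProb`), so starting from `s` instead of the all-ones state costs at most
`q⁻¹ ω(s) + q⁻²` more, uniformly in the discount factor (`valueIter_le_add`). Discounted value
functions relative to the all-ones state are thus pointwise bounded, and nonnegative by
monotonicity. As actions and outcomes are finite in number, a pointwise limit as `β → 1` solves the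
average-cost equation (`exists_averageCost_optimality_eq`).

For verification, the equation is telescoped along a policy. Since `h ≥ 0`, the minimizing policy
has average cost at most `J`. The lower bound must control `E[h(s_T)] ≤ C · E[ω(s_T)]` for arbitrary
policies: an average below `J` would force linearly growing expected costs, hence quadratic partial
sums, a contradiction (`le_of_sum_le_of_le_sum_add`). -/

namespace AoI

open Filter Topology

variable {K : ℕ}

/-! ### Ages, transitions and one-step expectations. -/

section Transitions

theorem one_le_avgAge (hK : 1 ≤ K) (s : State K) : 1 ≤ avgAge s := by
  have hK' : (0 : ℝ) < K := by exact_mod_cast hK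
  have h : ∑ _i : Fin K, (1 : ℝ) ≤ ∑ i, ((s i : ℕ) : ℝ) :=
    Finset.sum_le_sum fun i _ => by exact_mod_cast (one_le : 1 ≤ s i)
  simp only [Finset.sum_const, Finset.card_univ, Fintype.card_fin, nsmul_eq_mul, mul_one] at h
  rw [avgAge, one_div_mul_eq_div, le_div_iff₀ hK']
  linarith

theorem avgAge_mono : Monotone (avgAge : State K → ℝ) := fun s s' hs => by
  unfold avgAge
  refine mul_le_mul_of_nonneg_left (Finset.sum_le_sum fun i _ => ?_) (by positivity)
  exact_mod_cast hs i

theorem avgAge_nonneg (s : State K) : 0 ≤ avgAge s := by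
  unfold avgAge
  positivity

theorem avgAge_one (hK : 1 ≤ K) : avgAge (1 : State K) = 1 := by
  have hK' : (0 : ℝ) < K := by exact_mod_cast hK
  simp [avgAge, hK'.ne']

theorem avgAge_nextState_le (hK : 1 ≤ K) (s : State K) (x : Fin K → Bool) :
    avgAge (nextState s x) ≤ avgAge s + 1 := by
  have hK' : (0 : ℝ) < K := by exact_mod_cast hK
  have h : ∑ i, ((nextState s x i : ℕ) : ℝ) ≤ ∑ i, (((s i : ℕ) : ℝ) + 1) := by
    refine Finset.sum_le_sum fun i _ => ?_
    unfold nextState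
    split_ifs <;> simp
  rw [Finset.sum_add_distrib] at h
  simp only [Finset.sum_const, Finset.card_univ, Fintype.card_fin, nsmul_eq_mul, mul_one] at h
  unfold avgAge
  rw [one_div_mul_eq_div, one_div_mul_eq_div, div_add_one hK'.ne']
  gcongr

theorem nextState_mono (x : Fin K → Bool) : Monotone fun s : State K => nextState s x :=
  fun s s' hs i => by
    simp only [nextState]
    split_ifs
    · exact le_rfl
    · exact add_le_add_left (hs i) 1

theorem nextState_true (s : State K) : nextState s (fun _ => true) = 1 := by
  ext i
  simp [nextState]

theorem Params.errorProb_lt_one (p : Params K) (k : ℕ) : p.errorProb k < 1 := by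
  have h1 := p.c_nonneg
  have h2 : 0 < ∑ i ∈ Finset.range (p.N - k + 1),
      p.c ^ i / (i.factorial : ℝ) * Real.exp (-p.c) := by
    refine Finset.sum_pos' (fun i _ => by positivity) ⟨0, by simp, ?_⟩
    simpa using Real.exp_pos _
  unfold Params.errorProb
  linarith

/-- The probability that all devices succeed when all of them are scheduled. -/
noncomputable def Params.resetProb (p : Params K) : ℝ :=
  p.outcomeProb (fun _ => true) (fun _ => true)

theorem Params.resetProb_pos (p : Params K) : 0 < p.resetProb := by
  unfold Params.resetProb Params.outcomeProb Params.successProb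
  refine Finset.prod_pos fun i _ => ?_
  simpa using p.errorProb_lt_one _

theorem Params.resetProb_le_one (p : Params K) : p.resetProb ≤ 1 := by
  rw [← p.sum_outcomeProb (fun _ => true)]
  exact Finset.single_le_sum (f := p.outcomeProb fun _ => true)
    (fun x _ => p.outcomeProb_nonneg _ x) (Finset.mem_univ (fun _ : Fin K => true))

theorem Params.expNext_mono_of_le (p : Params K) {g g' : State K → ℝ} {s s' : State K}
    (a : Action K) (h : ∀ x, g (nextState s x) ≤ g' (nextState s' x)) :
    p.expNext g s a ≤ p.expNext g' s' a :=
  Finset.sum_le_sum fun x _ => mul_le_mul_of_nonneg_left (h x) (p.outcomeProb_nonneg a x)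

theorem Params.expNext_const (p : Params K) (b : ℝ) (s : State K) (a : Action K) :
    p.expNext (fun _ => b) s a = b := by
  rw [Params.expNext, ← Finset.sum_mul, p.sum_outcomeProb, one_mul]

theorem Params.expNext_sub_const (p : Params K) (g : State K → ℝ) (b : ℝ) (s : State K)
    (a : Action K) : p.expNext (fun s => g s - b) s a = p.expNext g s a - b := by
  simp only [Params.expNext, mul_sub, Finset.sum_sub_distrib, ← Finset.sum_mul,
    p.sum_outcomeProb, one_mul]

theorem Params.expNext_le (p : Params K) {g : State K → ℝ} {s : State K} (a : Action K) {b : ℝ}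
    (h : ∀ x, g (nextState s x) ≤ b) : p.expNext g s a ≤ b :=
  (p.expNext_mono_of_le (g' := fun _ => b) (s' := s) a h).trans_eq (p.expNext_const b s a)

theorem Params.expNext_nonneg (p : Params K) {g : State K → ℝ} (hg : ∀ s, 0 ≤ g s)
    (s : State K) (a : Action K) : 0 ≤ p.expNext g s a :=
  Finset.sum_nonneg fun x _ => mul_nonneg (p.outcomeProb_nonneg a x) (hg _)

/-- Only the all-success outcome is singled out, since it leads to the all-ones state whatever `s`
is. -/
theorem Params.expNext_scheduleAll_le (p : Params K) {g : State K → ℝ} {s : State K} {u v : ℝ}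
    (hu : g 1 ≤ u) (hv : ∀ x, g (nextState s x) ≤ v) :
    p.expNext g s (fun _ => true) ≤ p.resetProb * u + (1 - p.resetProb) * v := by
  classical
  have h : ∀ x ∈ (Finset.univ : Finset (Fin K → Bool)),
      p.outcomeProb (fun _ => true) x * g (nextState s x) ≤
      p.outcomeProb (fun _ => true) x * v +
        if x = (fun _ => true) then p.outcomeProb (fun _ => true) x * (u - v) else 0 := by
    intro x _
    have hx := p.outcomeProb_nonneg (fun _ => true) x
    split_ifs with hxt
    · rw [hxt, nextState_true, ← mul_add]
      rw [hxt] at hx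
      exact mul_le_mul_of_nonneg_left (by linarith) hx
    · rw [add_zero]
      exact mul_le_mul_of_nonneg_left (hv x) hx
  refine (Finset.sum_le_sum h).trans_eq ?_
  rw [Finset.sum_add_distrib, ← Finset.sum_mul, p.sum_outcomeProb,
    Finset.sum_ite_eq' Finset.univ, if_pos (Finset.mem_univ _)]
  unfold Params.resetProb
  ring

theorem Params.tendsto_expNext (p : Params K) {ι : Type*} {l : Filter ι} {G : ι → State K → ℝ}
    {g : State K → ℝ} (h : ∀ s, Tendsto (fun n => G n s) l (𝓝 (g s))) (s : State K)
    (a : Action K) : Tendsto (fun n => p.expNext (G n) s a) l (𝓝 (p.expNext g s a)) :=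
  tendsto_finsetSum _ fun _ _ => (h _).const_mul _

end Transitions

/-! ### Discounted value functions by value iteration. -/

section Discounted

/-- The Bellman operator with discount factor `β`. -/
noncomputable def Params.bellman (p : Params K) (β : ℝ) (g : State K → ℝ) (s : State K) : ℝ :=
  Finset.univ.inf' Finset.univ_nonempty fun a : Action K => cost s a + β * p.expNext g s a

theorem Params.bellman_le (p : Params K) (β : ℝ) (g : State K → ℝ) (s : State K) (a : Action K) :
    p.bellman β g s ≤ cost s a + β * p.expNext g s a :=
  Finset.inf'_le _ (Finset.mem_univ a)

theorem Params.exists_bellman_eq (p : Params K) (β : ℝ) (g : State K → ℝ) (s : State K) :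
    ∃ a, p.bellman β g s = cost s a + β * p.expNext g s a := by
  obtain ⟨a, -, ha⟩ := Finset.exists_mem_eq_inf' Finset.univ_nonempty
    fun a : Action K => cost s a + β * p.expNext g s a
  exact ⟨a, ha⟩

theorem Params.bellman_mono_of_le (p : Params K) {β : ℝ} (hβ : 0 ≤ β) {g g' : State K → ℝ}
    {s s' : State K} (hs : s ≤ s') (h : ∀ x, g (nextState s x) ≤ g' (nextState s' x)) :
    p.bellman β g s ≤ p.bellman β g' s' := by
  obtain ⟨a, ha⟩ := p.exists_bellman_eq β g' s'
  rw [ha]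
  exact (p.bellman_le β g s a).trans (add_le_add (avgAge_mono hs)
    (mul_le_mul_of_nonneg_left (p.expNext_mono_of_le a h) hβ))

theorem Params.tendsto_bellman (p : Params K) {ι : Type*} {l : Filter ι} {b : ι → ℝ} {β : ℝ}
    {G : ι → State K → ℝ} {g : State K → ℝ} (hb : Tendsto b l (𝓝 β))
    (h : ∀ s, Tendsto (fun n => G n s) l (𝓝 (g s))) (s : State K) :
    Tendsto (fun n => p.bellman (b n) (G n) s) l (𝓝 (p.bellman β g s)) := by
  unfold Params.bellman
  exact Tendsto.finset_inf'_nhds_apply _ fun a _ =>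
    (hb.mul (p.tendsto_expNext h s a)).const_add _

/-- Value iteration: the optimal `n`-stage discounted cost. -/
noncomputable def Params.valueIter (p : Params K) (β : ℝ) : ℕ → State K → ℝ
  | 0 => fun _ => 0
  | n + 1 => p.bellman β (p.valueIter β n)

variable (p : Params K) {β : ℝ}

theorem Params.valueIter_nonneg (hβ : 0 ≤ β) (n : ℕ) (s : State K) : 0 ≤ p.valueIter β n s := by
  induction n generalizing s with
  | zero => exact le_rfl
  | succ n ih =>
    obtain ⟨a, ha⟩ := p.exists_bellman_eq β (p.valueIter β n) s
    rw [Params.valueIter, ha]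
    exact add_nonneg (avgAge_nonneg s) (mul_nonneg hβ (p.expNext_nonneg ih s a))

theorem Params.valueIter_mono (hβ : 0 ≤ β) (n : ℕ) : Monotone (p.valueIter β n) := by
  induction n with
  | zero => exact fun _ _ _ => le_rfl
  | succ n ih => exact fun s s' hs => p.bellman_mono_of_le hβ hs fun x => ih (nextState_mono x hs)

theorem Params.valueIter_le_succ (hβ : 0 ≤ β) (n : ℕ) (s : State K) :
    p.valueIter β n s ≤ p.valueIter β (n + 1) s := by
  induction n generalizing s with
  | zero => exact p.valueIter_nonneg hβ 1 s
  | succ n ih => exact p.bellman_mono_of_le hβ le_rfl fun x => ih _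

/-- A crude bound, needed only for convergence of value iteration: the average age grows by at most
one per slot, and `∑ β ^ t (ω + t)` is at most the right-hand side. -/
theorem Params.valueIter_le (hK : 1 ≤ K) (hβ : 0 ≤ β) (hβ1 : β < 1) (n : ℕ) (s : State K) :
    p.valueIter β n s ≤ (1 - β)⁻¹ * avgAge s + (1 - β)⁻¹ ^ 2 := by
  have hr : 0 < (1 - β)⁻¹ := inv_pos.2 (by linarith)
  have hr1 : (1 - β) * (1 - β)⁻¹ = 1 := mul_inv_cancel₀ (by linarith)
  set r := (1 - β)⁻¹
  induction n generalizing s with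
  | zero =>
    have := avgAge_nonneg s
    simp only [Params.valueIter]
    positivity
  | succ n ih =>
    have h1 : p.expNext (p.valueIter β n) s (fun _ => true) ≤ r * (avgAge s + 1) + r ^ 2 :=
      p.expNext_le _ fun x => (ih _).trans (by
        gcongr
        exact avgAge_nextState_le hK s x)
    refine (p.bellman_le β _ s (fun _ => true)).trans ?_
    have h2 := mul_le_mul_of_nonneg_left h1 hβ
    have h3 : avgAge s + β * (r * (avgAge s + 1) + r ^ 2) = r * avgAge s + r ^ 2 - r * (1 - β) := by
      have hb : β * r = r - 1 := by linarith
      linear_combination (avgAge s + r) * hb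
    have h4 : 0 ≤ r * (1 - β) := by rw [mul_comm, hr1]; exact zero_le_one
    unfold cost
    linarith

/-- The bound is free of `β` and `n`. It reflects the cost accumulated while waiting a geometric
time for a full reset, with the age growing by at most one per slot. -/
theorem Params.valueIter_le_add (hK : 1 ≤ K) (hβ : 0 ≤ β) (hβ1 : β < 1) (n : ℕ) (s : State K) :
    p.valueIter β n s ≤
      p.valueIter β n 1 + (p.resetProb⁻¹ * avgAge s + p.resetProb⁻¹ ^ 2) := by
  have hr : 0 < p.resetProb⁻¹ := inv_pos.2 p.resetProb_pos
  have hr1 : p.resetProb * p.resetProb⁻¹ = 1 := mul_inv_cancel₀ p.resetProb_pos.ne'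
  have hq := p.resetProb_le_one
  set r := p.resetProb⁻¹
  induction n generalizing s with
  | zero =>
    have := avgAge_nonneg s
    simp only [Params.valueIter]
    positivity
  | succ n ih =>
    have hn := p.valueIter_le_succ hβ n 1
    have h0 : 0 ≤ p.expNext (p.valueIter β n) s (fun _ => true) :=
      p.expNext_nonneg (p.valueIter_nonneg hβ n) s _
    have h1 := p.expNext_scheduleAll_le (g := p.valueIter β n) (s := s) (le_refl _)
      (v := p.valueIter β n 1 + (r * (avgAge s + 1) + r ^ 2)) fun x => (ih _).trans (by
        gcongr
        exact avgAge_nextState_le hK s x)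
    have h2 := p.bellman_le β (p.valueIter β n) s (fun _ => true)
    -- Nonnegativity allows the factor `β` to be replaced by one.
    have h3 := mul_le_mul_of_nonneg_right hβ1.le h0
    have h4 : p.resetProb * p.valueIter β n 1 +
        (1 - p.resetProb) * (p.valueIter β n 1 + (r * (avgAge s + 1) + r ^ 2)) =
        p.valueIter β n 1 + (r * avgAge s + r ^ 2) - avgAge s - 1 := by
      linear_combination (-(avgAge s) - 1 - r) * hr1
    simp only [Params.valueIter, cost] at *
    linarith

theorem Params.exists_discounted_value (hK : 1 ≤ K) (hβ : 0 ≤ β) (hβ1 : β < 1) :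
    ∃ V : State K → ℝ, (∀ s, 0 ≤ V s) ∧ Monotone V ∧ (∀ s, V s = p.bellman β V s) ∧
      ∀ s, V s ≤ V 1 + (p.resetProb⁻¹ * avgAge s + p.resetProb⁻¹ ^ 2) := by
  have hlim : ∀ s, Tendsto (fun n => p.valueIter β n s) atTop (𝓝 (⨆ n, p.valueIter β n s)) :=
    fun s => tendsto_atTop_ciSup (monotone_nat_of_le_succ fun n => p.valueIter_le_succ hβ n s)
      ⟨_, Set.forall_mem_range.2 fun n => p.valueIter_le hK hβ hβ1 n s⟩
  refine ⟨fun s => ⨆ n, p.valueIter β n s, fun s => ?_, fun s s' hs => ?_, fun s => ?_,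
    fun s => ?_⟩
  · exact ge_of_tendsto' (hlim s) fun n => p.valueIter_nonneg hβ n s
  · exact le_of_tendsto_of_tendsto' (hlim s) (hlim s') fun n => p.valueIter_mono hβ n hs
  · exact tendsto_nhds_unique ((tendsto_add_atTop_iff_nat 1).2 (hlim s))
      (p.tendsto_bellman tendsto_const_nhds hlim s)
  · exact le_of_tendsto_of_tendsto' (hlim s) ((hlim 1).add_const _) fun n =>
      p.valueIter_le_add hK hβ hβ1 n s

end Discounted

/-! ### The vanishing-discount limit. -/

section AverageCost

theorem Params.bellman_sub_const (p : Params K) (β : ℝ) (g : State K → ℝ) (b : ℝ) (s : State K) :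
    p.bellman β (fun s => g s - b) s = p.bellman β g s - β * b := by
  apply le_antisymm
  · obtain ⟨a, ha⟩ := p.exists_bellman_eq β g s
    have := p.bellman_le β (fun s => g s - b) s a
    rw [p.expNext_sub_const] at this
    rw [ha]
    linarith
  · obtain ⟨a, ha⟩ := p.exists_bellman_eq β (fun s => g s - b) s
    have := p.bellman_le β g s a
    rw [p.expNext_sub_const] at ha
    rw [ha]
    linarith

/-- One ultrafilter serves all states at once, replacing a diagonal subsequence. -/
theorem _root_.Ultrafilter.exists_tendsto_of_mem_Icc {ι : Type*} (U : Ultrafilter ι) {f : ι → ℝ}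
    {a b : ℝ} (h : ∀ i, f i ∈ Set.Icc a b) : ∃ x ∈ Set.Icc a b, Tendsto f U (𝓝 x) :=
  isCompact_Icc.ultrafilter_le_nhds (U.map f)
    (le_principal_iff.2 (Filter.Eventually.of_forall (f := (U : Filter ι)) h))

/-- Vanishing discount: the average-cost optimality equation has a nonnegative solution
of at most linear growth. -/
theorem Params.exists_averageCost_optimality_eq (p : Params K) (hK : 1 ≤ K) :
    ∃ (J : ℝ) (h : State K → ℝ), 0 ≤ J ∧ (∀ s, 0 ≤ h s) ∧
      (∀ s, h s ≤ (p.resetProb⁻¹ + p.resetProb⁻¹ ^ 2) * avgAge s) ∧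
      ∀ s, J + h s = p.bellman 1 h s := by
  have hr : 0 < p.resetProb⁻¹ := inv_pos.2 p.resetProb_pos
  set r := p.resetProb⁻¹ with hr_def
  let b : ℕ → ℝ := fun n => 1 - 1 / ((n : ℝ) + 1)
  have hb0 : ∀ n, 0 ≤ b n := fun n => by
    have : 1 / ((n : ℝ) + 1) ≤ 1 := by
      rw [div_le_one (by positivity)]
      linarith [(Nat.cast_nonneg n : (0 : ℝ) ≤ n)]
    simp only [b]
    linarith
  have hb1 : ∀ n, b n < 1 := fun n => by
    have : 0 < 1 / ((n : ℝ) + 1) := by positivity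
    simp only [b]
    linarith
  have hb : Tendsto b atTop (𝓝 1) := by
    simpa [b] using (tendsto_one_div_add_atTop_nhds_zero_nat (𝕜 := ℝ)).const_sub 1
  choose V hV0 hVm hVb hVle using fun n => p.exists_discounted_value hK (hb0 n) (hb1 n)
  let G : ℕ → State K → ℝ := fun n s => V n s - V n 1
  have hG0 : ∀ n s, 0 ≤ G n s := fun n s => sub_nonneg.2 (hVm n fun i => one_le)
  have hGle : ∀ n s, G n s ≤ (r + r ^ 2) * avgAge s := fun n s => by
    have h1 := hVle n s
    have h2 : r ^ 2 * 1 ≤ r ^ 2 * avgAge s := by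
      gcongr
      exact one_le_avgAge hK s
    simp only [G]
    linarith
  have hGb : ∀ n s, (1 - b n) * V n 1 + G n s = p.bellman (b n) (G n) s := fun n s => by
    rw [p.bellman_sub_const, ← hVb n s]
    simp only [G]
    ring
  -- The normalized equation is read at the all-ones state: scheduling all devices costs 1 now, and
  -- the next average age is at most 2.
  have hJ : ∀ n, (1 - b n) * V n 1 ∈ Set.Icc 0 (1 + (r + r ^ 2) * 2) := fun n => by
    refine ⟨mul_nonneg (by linarith [hb1 n]) (hV0 n 1), ?_⟩
    have h1 := hGb n 1
    have h2 := p.bellman_le (b n) (G n) 1 (fun _ => true)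
    have h3 : p.expNext (G n) 1 (fun _ => true) ≤ (r + r ^ 2) * 2 :=
      p.expNext_le _ fun x => (hGle n _).trans (by
        gcongr
        have := avgAge_nextState_le hK 1 x
        rw [avgAge_one hK] at this
        linarith)
    have h4 := mul_le_mul_of_nonneg_right (hb1 n).le (p.expNext_nonneg (hG0 n) 1 fun _ => true)
    have h5 : cost (1 : State K) (fun _ => true) = 1 := avgAge_one hK
    have h6 := hG0 n 1
    linarith
  let U : Ultrafilter ℕ := hyperfilter ℕ
  have hU : (U : Filter ℕ) ≤ atTop := Nat.hyperfilter_le_atTop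
  obtain ⟨J, hJmem, hJlim⟩ := U.exists_tendsto_of_mem_Icc hJ
  choose h hmem hlim using fun s =>
    U.exists_tendsto_of_mem_Icc (f := fun n => G n s) fun n => ⟨hG0 n s, hGle n s⟩
  refine ⟨J, h, hJmem.1, fun s => (hmem s).1, fun s => (hmem s).2, fun s => ?_⟩
  have h1 := p.tendsto_bellman (hb.mono_left hU) hlim s
  simp only [← hGb] at h1
  exact tendsto_nhds_unique (hJlim.add (hlim s)) h1

end AverageCost

/-! ### Expected costs along a policy. -/

section Expectation

/-- The expectation of a nonnegative function under a discrete law. -/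
noncomputable def mean {α : Type*} (q : PMF α) (g : α → ENNReal) : ENNReal := ∑' a, q a * g a

theorem mean_pure {α : Type*} (a : α) (g : α → ENNReal) : mean (PMF.pure a) g = g a := by
  rw [mean, tsum_eq_single a]
  · simp
  · intro b hb
    simp [hb]

theorem mean_bind {α β : Type*} (q : PMF α) (k : α → PMF β) (g : β → ENNReal) :
    mean (q.bind k) g = mean q fun a => mean (k a) g := by
  simp only [mean, PMF.bind_apply, ← ENNReal.tsum_mul_left, ← ENNReal.tsum_mul_right]
  rw [ENNReal.tsum_comm]
  simp only [mul_assoc]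

theorem mean_map {α β : Type*} (q : PMF α) (k : α → β) (g : β → ENNReal) :
    mean (q.map k) g = mean q (g ∘ k) := by
  rw [PMF.map, mean_bind]
  simp only [Function.comp_apply, mean_pure]
  rfl

theorem mean_const {α : Type*} (q : PMF α) (b : ENNReal) : mean q (fun _ => b) = b := by
  rw [mean, ENNReal.tsum_mul_right, q.tsum_coe, one_mul]

theorem mean_add {α : Type*} (q : PMF α) (g g' : α → ENNReal) :
    mean q (fun a => g a + g' a) = mean q g + mean q g' := by
  simp only [mean, mul_add, ENNReal.tsum_add]

theorem mean_const_mul {α : Type*} (q : PMF α) (b : ENNReal) (g : α → ENNReal) :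
    mean q (fun a => b * g a) = b * mean q g := by
  simp only [mean, mul_left_comm _ b, ENNReal.tsum_mul_left]

theorem mean_mono {α : Type*} (q : PMF α) {g g' : α → ENNReal} (h : ∀ a, g a ≤ g' a) :
    mean q g ≤ mean q g' :=
  ENNReal.tsum_le_tsum fun a => mul_le_mul_right (h a) _

variable (p : Params K)

theorem Params.mean_trans {g : State K → ℝ} (hg : ∀ s, 0 ≤ g s) (s : State K) (a : Action K) :
    mean (p.trans s a) (fun s' => ENNReal.ofReal (g s')) = ENNReal.ofReal (p.expNext g s a) := by
  rw [Params.trans, mean_map, mean, tsum_fintype, Params.expNext, ENNReal.ofReal_sum_of_nonneg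
    fun x _ => mul_nonneg (p.outcomeProb_nonneg a x) (hg _)]
  refine Finset.sum_congr rfl fun x _ => ?_
  rw [ENNReal.ofReal_mul (p.outcomeProb_nonneg a x)]
  rfl

/-- The expectation of `g(s_t)`. -/
noncomputable def Params.stateMean (π : Policy K) (s₀ : State K) (t : ℕ) (g : State K → ENNReal) :
    ENNReal :=
  mean (p.historyLaw π s₀ t) fun H => g H.2

theorem Params.stateMean_zero (π : Policy K) (s₀ : State K) (g : State K → ENNReal) :
    p.stateMean π s₀ 0 g = g s₀ :=
  mean_pure _ _

theorem Params.stateMean_succ (π : Policy K) (s₀ : State K) (t : ℕ) (g : State K → ENNReal) :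
    p.stateMean π s₀ (t + 1) g = mean (p.historyLaw π s₀ t) fun H =>
      mean (π H.1 H.2) fun a => mean (p.trans H.2 a) g := by
  simp only [Params.stateMean, Params.historyLaw, mean_bind, mean_map]
  rfl

theorem Params.expCost_eq (π : Policy K) (s₀ : State K) (t : ℕ) :
    p.expCost π s₀ t = p.stateMean π s₀ t fun s => ENNReal.ofReal (avgAge s) := by
  change mean (p.stateActionLaw π s₀ t) (fun z => ENNReal.ofReal (cost z.1 z.2)) = _
  simp only [Params.stateActionLaw, mean_bind, mean_map]
  simp only [Function.comp_def, cost, mean_const]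
  rfl

variable {p} {J : ℝ} {h : State K → ℝ}

/-- The optimality inequality integrated over the history; the additive form avoids subtraction,
since expectations may be infinite. -/
theorem Params.add_stateMean_le (hJ : 0 ≤ J) (hh : ∀ s, 0 ≤ h s)
    (hopt : ∀ s a, J + h s ≤ cost s a + p.expNext h s a) (π : Policy K) (s₀ : State K) (t : ℕ) :
    ENNReal.ofReal J + p.stateMean π s₀ t (fun s => ENNReal.ofReal (h s)) ≤
      p.expCost π s₀ t + p.stateMean π s₀ (t + 1) fun s => ENNReal.ofReal (h s) := by
  rw [p.expCost_eq, p.stateMean_succ, Params.stateMean, Params.stateMean, ← mean_add]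
  conv_lhs => rw [← mean_const (p.historyLaw π s₀ t) (ENNReal.ofReal J), ← mean_add]
  refine mean_mono _ fun H => ?_
  rw [← mean_const (π H.1 H.2) (ENNReal.ofReal J + _),
    ← mean_const (π H.1 H.2) (ENNReal.ofReal (avgAge H.2)), ← mean_add]
  refine mean_mono _ fun a => ?_
  rw [p.mean_trans hh, ← ENNReal.ofReal_add hJ (hh _),
    ← ENNReal.ofReal_add (avgAge_nonneg _) (p.expNext_nonneg hh _ _)]
  exact ENNReal.ofReal_le_ofReal (hopt _ _)

theorem Params.expCost_stationary_add_stateMean (hJ : 0 ≤ J) (hh : ∀ s, 0 ≤ h s)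
    {f : State K → Action K} (hf : ∀ s, J + h s = cost s (f s) + p.expNext h s (f s))
    (s₀ : State K) (t : ℕ) :
    p.expCost (stationary f) s₀ t +
        p.stateMean (stationary f) s₀ (t + 1) (fun s => ENNReal.ofReal (h s)) =
      ENNReal.ofReal J + p.stateMean (stationary f) s₀ t fun s => ENNReal.ofReal (h s) := by
  rw [p.expCost_eq, p.stateMean_succ, Params.stateMean, Params.stateMean, ← mean_add]
  conv_rhs => rw [← mean_const (p.historyLaw (stationary f) s₀ t) (ENNReal.ofReal J), ← mean_add]
  congr 1
  funext H
  rw [stationary, mean_pure, p.mean_trans hh, ← ENNReal.ofReal_add hJ (hh _),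
    ← ENNReal.ofReal_add (avgAge_nonneg _) (p.expNext_nonneg hh _ _), hf]
  rfl

theorem Params.sum_expCost_stationary_le (hJ : 0 ≤ J) (hh : ∀ s, 0 ≤ h s)
    {f : State K → Action K} (hf : ∀ s, J + h s = cost s (f s) + p.expNext h s (f s))
    (s₀ : State K) (T : ℕ) :
    ∑ t ∈ Finset.range T, p.expCost (stationary f) s₀ t ≤ ENNReal.ofReal (T * J + h s₀) := by
  -- The identity telescopes exactly; the nonnegative terminal term is then dropped.
  suffices H : ∑ t ∈ Finset.range T, p.expCost (stationary f) s₀ t +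
      p.stateMean (stationary f) s₀ T (fun s => ENNReal.ofReal (h s)) =
      ENNReal.ofReal (T * J + h s₀) from H ▸ le_self_add
  induction T with
  | zero => simp [p.stateMean_zero]
  | succ T ih =>
    rw [Finset.sum_range_succ, add_assoc, p.expCost_stationary_add_stateMean hJ hh hf,
      add_left_comm, ih, ← ENNReal.ofReal_add hJ (by have := hh s₀; positivity)]
    push_cast
    ring_nf

theorem Params.ofReal_le_sum_expCost_add (hJ : 0 ≤ J) (hh : ∀ s, 0 ≤ h s)
    (hopt : ∀ s a, J + h s ≤ cost s a + p.expNext h s a) {C : ℝ} (hC : 0 ≤ C)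
    (hle : ∀ s, h s ≤ C * avgAge s) (π : Policy K) (s₀ : State K) (T : ℕ) :
    ENNReal.ofReal (T * J) ≤
      ∑ t ∈ Finset.range T, p.expCost π s₀ t + ENNReal.ofReal C * p.expCost π s₀ T := by
  have H : ENNReal.ofReal (T * J) ≤ ∑ t ∈ Finset.range T, p.expCost π s₀ t +
      p.stateMean π s₀ T (fun s => ENNReal.ofReal (h s)) := by
    induction T with
    | zero => simp
    | succ T ih =>
      rw [Finset.sum_range_succ, add_assoc]
      refine le_trans ?_ (add_le_add_right (p.add_stateMean_le hJ hh hopt π s₀ T) _)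
      rw [add_left_comm]
      refine le_trans ?_ (add_le_add_right ih _)
      rw [← ENNReal.ofReal_add hJ (by positivity)]
      push_cast
      exact ENNReal.ofReal_le_ofReal (by linarith)
  refine H.trans (add_le_add_right ?_ _)
  rw [p.expCost_eq, Params.stateMean, Params.stateMean, ← mean_const_mul]
  refine mean_mono _ fun H => ?_
  rw [← ENNReal.ofReal_mul hC]
  exact ENNReal.ofReal_le_ofReal (hle _)

end Expectation

/-! ### Passage to long-run averages. -/

section Limits

/-- If the partial sums of a nonnegative sequence grow at rate at most `L`, then
`T * J ≤ ∑ t < T, e t + C * e T` for all `T` forces `J ≤ L`. -/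
theorem le_of_sum_le_of_le_sum_add {e : ℕ → ℝ} {J L C : ℝ} (he : ∀ t, 0 ≤ e t) (hC : 0 < C)
    {T₀ : ℕ} (hL : ∀ T ≥ T₀, ∑ t ∈ Finset.range (T + 1), e t ≤ L * T)
    (hJ : ∀ T : ℕ, T * J ≤ ∑ t ∈ Finset.range T, e t + C * e T) : J ≤ L := by
  by_contra! hlt
  have hε : 0 < (J - L) / C := div_pos (by linarith) hC
  set ε := (J - L) / C with hε_def
  -- The slack `T * (J - L)` must be absorbed by `C * e T`.
  have hlin : ∀ T ≥ T₀, ε * T ≤ e T := fun T hT => by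
    have h1 := hL T hT
    rw [Finset.sum_range_succ] at h1
    have h2 := hJ T
    have h3 := he T
    rw [hε_def, div_mul_eq_mul_div, div_le_iff₀ hC]
    linarith
  obtain ⟨n, hn⟩ := exists_nat_gt (2 * L / ε)
  let T := max (max n T₀) 1
  have hTn : (n : ℝ) ≤ T := by exact_mod_cast (le_max_left n T₀).trans (le_max_left _ 1)
  have hT₀ : T₀ ≤ T := (le_max_right n T₀).trans (le_max_left _ 1)
  have hT1 : (0 : ℝ) < T := by exact_mod_cast (le_max_right (max n T₀) 1)
  -- Summing the linear bound over `[T, 2T)` gives `ε T²`, against an upper bound `2LT`.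
  have hlow : (T : ℝ) * (ε * T) ≤ ∑ t ∈ Finset.Ico T (2 * T), e t := by
    have : ∑ _t ∈ Finset.Ico T (2 * T), ε * T ≤ ∑ t ∈ Finset.Ico T (2 * T), e t := by
      refine Finset.sum_le_sum fun t ht => ?_
      have ht' := (Finset.mem_Ico.1 ht).1
      refine le_trans ?_ (hlin t (hT₀.trans ht'))
      gcongr
    rwa [Finset.sum_const, Nat.card_Ico, nsmul_eq_mul, show 2 * T - T = T by omega] at this
  have hup : ∑ t ∈ Finset.Ico T (2 * T), e t ≤ ∑ t ∈ Finset.range (2 * T + 1), e t := by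
    refine Finset.sum_le_sum_of_subset_of_nonneg (fun t ht => ?_) fun t _ _ => he t
    rw [Finset.mem_Ico] at ht
    rw [Finset.mem_range]
    omega
  have h2T := hL (2 * T) (by omega)
  push_cast at h2T
  have h1 : T * (ε * T) ≤ T * (2 * L) := by linarith
  have h2 : ε * T ≤ 2 * L := le_of_mul_le_mul_left h1 hT1
  rw [div_lt_iff₀ hε] at hn
  nlinarith

variable {p : Params K} {J : ℝ} {h : State K → ℝ}

theorem Params.avgCost_stationary_le (hJ : 0 ≤ J) (hh : ∀ s, 0 ≤ h s)
    {f : State K → Action K} (hf : ∀ s, J + h s = cost s (f s) + p.expNext h s (f s))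
    (s₀ : State K) : p.avgCost (stationary f) s₀ ≤ ENNReal.ofReal J := by
  -- The extra `J` in the numerator comes from having `T + 1` terms but dividing by `T`.
  have hlim : Tendsto (fun T : ℕ => ENNReal.ofReal (J + (J + h s₀) / T)) atTop
      (𝓝 (ENNReal.ofReal J)) := by
    refine ENNReal.tendsto_ofReal ?_
    simpa using (tendsto_const_div_atTop_nhds_zero_nat (J + h s₀)).const_add J
  rw [← hlim.limsup_eq]
  refine limsup_le_limsup ?_
  filter_upwards [eventually_gt_atTop 0] with T hT
  have hT' : (0 : ℝ) < T := by exact_mod_cast hT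
  rw [← ENNReal.ofReal_natCast T]
  refine (ENNReal.div_le_div_right (p.sum_expCost_stationary_le hJ hh hf s₀ (T + 1)) _).trans ?_
  rw [← ENNReal.ofReal_div_of_pos hT']
  refine ENNReal.ofReal_le_ofReal (le_of_eq ?_)
  field_simp
  push_cast
  ring

theorem Params.le_avgCost (hJ : 0 ≤ J) (hh : ∀ s, 0 ≤ h s)
    (hopt : ∀ s a, J + h s ≤ cost s a + p.expNext h s a) {C : ℝ} (hC : 0 < C)
    (hle : ∀ s, h s ≤ C * avgAge s) (π : Policy K) (s₀ : State K) :
    ENNReal.ofReal J ≤ p.avgCost π s₀ := by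
  by_contra! hlt
  obtain ⟨L, hL1, hL2⟩ := ENNReal.lt_iff_exists_nnreal_btwn.1 hlt
  obtain ⟨T₀, hT₀⟩ := eventually_atTop.1 (eventually_lt_of_limsup_lt hL1)
  have hsum : ∀ T ≥ max T₀ 1,
      ∑ t ∈ Finset.range (T + 1), p.expCost π s₀ t ≤ (L : ENNReal) * T := fun T hT => by
    have hT1 : T ≠ 0 := by have := le_max_right T₀ 1; omega
    exact (ENNReal.div_le_iff (by exact_mod_cast hT1) (ENNReal.natCast_ne_top T)).1
      (hT₀ T ((le_max_left _ _).trans hT)).le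
  -- An average cost below `J` makes every expected cost finite, so the argument can move to real
  -- numbers.
  have hfin : ∀ t, p.expCost π s₀ t ≠ ⊤ := fun t => by
    refine ne_top_of_le_ne_top (ENNReal.mul_ne_top ENNReal.coe_ne_top
      (ENNReal.natCast_ne_top (max t (max T₀ 1)))) (le_trans ?_ (hsum _ (le_max_right t _)))
    refine Finset.single_le_sum (f := p.expCost π s₀) (fun _ _ => zero_le) ?_
    rw [Finset.mem_range]
    have := le_max_left t (max T₀ 1)
    omega
  have hkey : J ≤ L := by
    refine le_of_sum_le_of_le_sum_add (e := fun t => (p.expCost π s₀ t).toReal)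
      (fun t => ENNReal.toReal_nonneg) hC (T₀ := max T₀ 1) (fun T hT => ?_) fun T => ?_
    · have := ENNReal.toReal_mono
        (ENNReal.mul_ne_top ENNReal.coe_ne_top (ENNReal.natCast_ne_top T)) (hsum T hT)
      rwa [ENNReal.toReal_sum fun t _ => hfin t, ENNReal.toReal_mul, ENNReal.coe_toReal,
        ENNReal.toReal_natCast] at this
    · have hs : ∑ t ∈ Finset.range T, p.expCost π s₀ t ≠ ⊤ := ENNReal.sum_ne_top.2 fun t _ => hfin t
      have hm := ENNReal.mul_ne_top (ENNReal.ofReal_ne_top (r := C)) (hfin T)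
      have := ENNReal.toReal_mono (ENNReal.add_ne_top.2 ⟨hs, hm⟩)
        (p.ofReal_le_sum_expCost_add hJ hh hopt hC.le hle π s₀ T)
      rwa [ENNReal.toReal_add hs hm, ENNReal.toReal_sum fun t _ => hfin t, ENNReal.toReal_mul,
        ENNReal.toReal_ofReal (by positivity), ENNReal.toReal_ofReal hC.le] at this
  refine absurd hL2 (not_lt.2 ?_)
  rw [← ENNReal.ofReal_coe_nnreal]
  exact ENNReal.ofReal_le_ofReal hkey

end Limits

end AoI

theorem theorem1 (K : ℕ) (hK : 1 ≤ K) (p : AoI.Params K) :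
    ∃ (J : ℝ) (h : AoI.State K → ℝ) (f : AoI.State K → AoI.Action K),
      (∃ C : ℝ, ∀ s, |h s| ≤ C * AoI.avgAge s) ∧
      (∀ s, IsLeast (Set.range fun a : AoI.Action K => AoI.cost s a + p.expNext h s a) (J + h s)) ∧
      (∀ s, J + h s = AoI.cost s (f s) + p.expNext h s (f s)) ∧
      (∀ s₀, p.avgCost (AoI.stationary f) s₀ = ENNReal.ofReal J ∧
        ∀ π : AoI.Policy K, ENNReal.ofReal J ≤ p.avgCost π s₀) := by
  obtain ⟨J, h, hJ, hh, hle, hb⟩ := p.exists_averageCost_optimality_eq hK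
  have hr : 0 < p.resetProb⁻¹ := inv_pos.2 p.resetProb_pos
  have hopt : ∀ s a, J + h s ≤ AoI.cost s a + p.expNext h s a := fun s a => by
    simpa [hb s] using p.bellman_le 1 h s a
  choose f hf' using p.exists_bellman_eq 1 h
  have hf : ∀ s, J + h s = AoI.cost s (f s) + p.expNext h s (f s) := fun s => by
    rw [hb s, hf' s, one_mul]
  have hlow : ∀ (π : AoI.Policy K) s₀, ENNReal.ofReal J ≤ p.avgCost π s₀ :=
    p.le_avgCost hJ hh hopt (by positivity) hle
  refine ⟨J, h, f, ⟨_, fun s => (abs_of_nonneg (hh s)).trans_le (hle s)⟩,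
    fun s => ⟨⟨f s, (hf s).symm⟩, Set.forall_mem_range.2 (hopt s)⟩, hf, fun s₀ =>
    ⟨le_antisymm (p.avgCost_stationary_le hJ hh hf s₀) (hlow _ s₀), fun π => hlow π s₀⟩⟩
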